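/- **Setting.** A Tanner graph consists of a finite set $V$ of variable nodes, a finite set $C$ of check nodes and a neighbourhood $N(c)\subseteq V$ for each $c\in C$. Let $\zeta_c$ be the set of $z\in\{0,1\}^V$ for which $\sum_{v\in N(c)}z_v$ is even, and let $P=\bigcap_{c\in C}\operatorname{conv}(\zeta_c)\subseteq\mathbb R^V$ be the fundamental polytope. For an error pattern $\eta\in\{0,1\}^V$ (with the all-zeros codeword transmitted), LP decoding succeeds if $0$ is the unique minimizer over $P$ of $\sum_{v}(-1)^{\eta_v}x_v$; otherwise there is an LP error. On the $\epsilon$-BSC, $0<\epsilon<1/2$, the bits $\eta_v$ are independent and equal to $1$ with probability $\epsilon$. An ensemble is a probability distribution over codes (given by their Tanner graphs). The LP threshold on the BSC of a sequence $(\Gamma_t)_{t\in\mathbb N}$ of ensembles is $$\xi=\sup\Big\{\epsilon\in(0,\tfrac12)\ :\ \Pr_{\zeta\sim\Gamma_t,\ \epsilon\text{-BSC}}[\text{LP error on }\zeta]=o(1)\text{ as }t\to\infty\Big\},\qquad \sup\emptyset=0 .$$ Let $d_v\ge 3$ be odd, $k\ge 2$, $d_c=kd_v$ and $\hat d_v=(d_v-1)/2$.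 For $L\ge 0$ and $M\geq 1$ divisible by $k$, a $(d_v,d_c,L,M)$ graph cover code has $M$ variable nodes and $Md_v/d_c=M/k$ check nodes at each position of $[-L:L]$, positions being taken modulo $2L+1$, such that (i) a check node at position $j$ is joined to exactly $k$ variable nodes at position $j+i$ for every $i\in[-\hat d_v:\hat d_v]$, and to no other variable nodes; (ii) no two check nodes at the same position are joined to the same variable node. Cutting such a code $\zeta$ at position $i$ means removing all variable nodes at the positions $i+j$, $j\in[0:2\hat d_v-1]$, with their edges; the result is the derived spatially coupled code $\zeta'_i$. **Theorem.** Let $d_v\ge 3$ be odd, $k\ge 2$ and $d_c=kd_v$. There is $\nu>0$, depending only on $d_v$ and $d_c$, with the following property. Let $L=L_t\to\infty$, let $M=M_t\ge 1$ be divisible by $k$, and for each $t$ let $\Gamma_{GC}=\Gamma_{GC,t}$ be an arbitrary probability distribution over $(d_v,d_c,L,M)$ graph cover codes. Let $\Gamma_{SC}$ be the ensemble sampled by drawing $\zeta\sim\Gamma_{GC}$ and returning $\zeta'_i$ for an independent, uniformly random position $i\in[-L:L]$. Let $\xi_{GC}$ and $\xi_{SC}$ be the LP thresholds of $\Gamma_{GC}$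 and $\Gamma_{SC}$ on the BSC. If $M=o(L^{\nu})$ and, for every constant $\Delta$ with $0<\Delta<\xi_{SC}$, $$\Pr_{\zeta'\sim\Gamma_{SC},\ (\xi_{SC}-\Delta)\text{-BSC}}[\text{LP error on }\zeta']=o\!\left(\frac1{L^2}\right),$$ then $\xi_{GC}=\xi_{SC}$. -/

import Mathlib

/-- A finite Tanner graph: variable nodes `V`, check nodes `C`, and for every check node `c`
the set `nbr c` of the variable nodes joined to it.  -/
structure TannerGraph where
  V : Type
  C : Type
  [fintypeV : Fintype V]
  [fintypeC : Fintype C]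
  nbr : C → Finset V

namespace TannerGraph

attribute [instance] fintypeV fintypeC

/-- The 0/1 vectors that satisfy the single parity check `c`. -/
def localCode (T : TannerGraph) (c : T.C) : Set (T.V → ℝ) :=
  {z | (∀ v, z v = 0 ∨ z v = 1) ∧ Even {v : T.V | v ∈ T.nbr c ∧ z v = 1}.ncard}

/-- The fundamental polytope: the intersection of the convex hulls of the local codes. -/
def fundamentalPolytope (T : TannerGraph) : Set (T.V → ℝ) :=
  ⋂ c : T.C, convexHull ℝ (T.localCode c)

/-- The normalized log-likelihood ratios on the BSC when the all-zeros codeword is sent and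
`η` is the error pattern (`true` is a flipped bit). -/
def llr (T : TannerGraph) (η : T.V → Bool) (v : T.V) : ℝ :=
  if η v then -1 else 1

/-- The objective function of the decoding linear program. -/
def lpCost (T : TannerGraph) (η : T.V → Bool) (x : T.V → ℝ) : ℝ :=
  ∑ v, T.llr η v * x v

/-- LP decoding succeeds for `η`: the zero codeword is the unique optimal solution. -/
def LPSuccess (T : TannerGraph) (η : T.V → Bool) : Prop :=
  {x | x ∈ T.fundamentalPolytope ∧ IsMinOn (T.lpCost η) T.fundamentalPolytope x} = {0}

open Classical in
/-- The probability that LP decoding fails on `T` over the BSC with crossover probability `ε`. -/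
noncomputable def lpErrorProb (T : TannerGraph) (ε : ℝ) : ℝ :=
  ∑ η : T.V → Bool, if T.LPSuccess η then 0 else ∏ v, (if η v then ε else 1 - ε)

end TannerGraph

/-- The LP error probability of an ensemble (a probability distribution over codes, each given
by its Tanner graph) on the BSC with crossover probability `ε`. -/
noncomputable def ensembleErrorProb (Γ : PMF TannerGraph) (ε : ℝ) : ℝ :=
  ∑' T : TannerGraph, (Γ T).toReal * T.lpErrorProb ε

/-- The LP threshold on the BSC of a sequence of ensembles: the supremum of the crossover
probabilities at which the LP error probability is `o(1)` along the sequence.  The set is bounded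
above; if it is empty, the value is `0`. -/
noncomputable def lpThreshold (Γ : ℕ → PMF TannerGraph) : ℝ :=
  sSup {ε : ℝ | 0 < ε ∧ ε < 1 / 2 ∧
    (fun t => ensembleErrorProb (Γ t) ε) =o[Filter.atTop] (fun _ => (1 : ℝ))}

/-- A `(d_v, d_c = k d_v, L, M)` graph cover code.  The positions `[-L : L]`, with arithmetic
`mod [-L : L]`, are the elements of `ZMod (2 * L + 1)`; there are `M` variable nodes and
`M d_v / d_c = M / k` check nodes at each position, and `(d_v - 1) / 2` is the half-width of the
window of positions that a check node sees. -/
structure GraphCoverCode (dv k L M : ℕ) where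
  nbr : ZMod (2 * L + 1) × Fin (M / k) → Finset (ZMod (2 * L + 1) × Fin M)
  /-- A check node is joined only to variable nodes at positions in its window. -/
  window : ∀ c, ∀ v ∈ nbr c,
    ∃ i ∈ Finset.Icc (-(((dv - 1) / 2 : ℕ) : ℤ)) (((dv - 1) / 2 : ℕ) : ℤ),
      v.1 = c.1 + (i : ZMod (2 * L + 1))
  /-- A check node is joined to exactly `k` variable nodes at each position in its window. -/
  card_window : ∀ c,
    ∀ i ∈ Finset.Icc (-(((dv - 1) / 2 : ℕ) : ℤ)) (((dv - 1) / 2 : ℕ) : ℤ),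
      ((nbr c).filter fun v => v.1 = c.1 + (i : ZMod (2 * L + 1))).card = k
  /-- No two check nodes at the same position are joined to the same variable node. -/
  disjoint : ∀ c c', c ≠ c' → c.1 = c'.1 → Disjoint (nbr c) (nbr c')

namespace GraphCoverCode

variable {dv k L M : ℕ}

/-- The Tanner graph of a graph cover code. -/
def toTanner (ζ : GraphCoverCode dv k L M) : TannerGraph where
  V := ZMod (2 * L + 1) × Fin M
  C := ZMod (2 * L + 1) × Fin (M / k)
  nbr := ζ.nbr

/-- The derived spatially coupled code with cut position `i`: all variable nodes at the positions
`i, i + 1, …, i + (d_v - 2)` and their edges are removed; all check nodes stay. -/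
def cut (ζ : GraphCoverCode dv k L M) (i : ZMod (2 * L + 1)) : TannerGraph where
  V := {v : ZMod (2 * L + 1) × Fin M //
    ∀ j ∈ Finset.range (2 * ((dv - 1) / 2)), v.1 ≠ i + (j : ZMod (2 * L + 1))}
  C := ZMod (2 * L + 1) × Fin (M / k)
  nbr c := (ζ.nbr c).subtype _

end GraphCoverCode

/-- The distribution over codes that belongs to a distribution over graph cover codes. -/
noncomputable def coverEnsemble {dv k L M : ℕ} (Γ : PMF (GraphCoverCode dv k L M)) :
    PMF TannerGraph :=
  Γ.map GraphCoverCode.toTanner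

/-- The derived spatially coupled ensemble: draw a graph cover code and cut it at a uniformly
random position. -/
noncomputable def coupledEnsemble {dv k L M : ℕ} (Γ : PMF (GraphCoverCode dv k L M)) :
    PMF TannerGraph :=
  Γ.bind fun ζ => (PMF.uniformOfFintype (ZMod (2 * L + 1))).map ζ.cut

/-! LP decoding succeeds iff every nonzero vector of the parity cone has positive cost
(`lpSuccess_iff`). Cutting a code keeps only the cone vectors that vanish on the cut, so a cut code
is never harder to decode than its cover; this gives one inequality of thresholds.

For the other, let `x` be a cone vector of the cover, of total weight `S`. Near any cut, `x` can be
changed into a cone vector vanishing there (`parityCone_repair`), at a price `O(M)` times the weight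
of `x` near the cut. Averaged over all cuts the price is `O(M / L) * S`, so the cost of `x` is at
least `-(f + O(M / L)) * S`, where `f` is the fraction of cuts at which decoding fails (`cost_ge`).

This slightly negative bound becomes positive by degrading the channel: flip each zero of the error
pattern with probability `β`. The mean cost becomes `(1 - β) * cost - β * S`, so the original cost
is positive once `β` exceeds the mean of `f` plus `O(M / L)`. Hence the cover's error probability is
at most `1 / (β - O(M / L))` times that of the coupled ensemble on the noisier channel
(`lpErrorProb_toTanner_mul_le`). Any fixed `β > 0` suffices when `M = o(L)`. -/

/-! ### LP success in terms of the parity cone -/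

/-- The cone at the origin of the fundamental polytope: nonnegative vectors such that, at each
check, no coordinate exceeds the sum of the others. -/
def ParityCone {V C : Type} (nbr : C → Finset V) (x : V → ℝ) : Prop :=
  (∀ v, 0 ≤ x v) ∧ ∀ c, ∀ v ∈ nbr c, 2 * x v ≤ ∑ u ∈ nbr c, x u

/-- The normalized log-likelihood ratio of a bit. -/
def bscSign (b : Bool) : ℝ := if b then -1 else 1

theorem abs_bscSign (b : Bool) : |bscSign b| = 1 := by
  cases b <;> simp [bscSign]

namespace TannerGraph

/-- The cone inequalities are convex, and they hold at the points of a local code because an even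
nonempty support within a check has at least two elements. -/
theorem parityCone_of_mem_fundamentalPolytope (T : TannerGraph) [Nonempty T.C] {x : T.V → ℝ}
    (hx : x ∈ T.fundamentalPolytope) : ParityCone T.nbr x := by
  classical
  have hx : ∀ c, x ∈ convexHull ℝ (T.localCode c) := by
    simpa [fundamentalPolytope] using hx
  have key : ∀ c, x ∈ {y : T.V → ℝ | (∀ v, 0 ≤ y v) ∧
      ∀ v ∈ T.nbr c, 2 * y v ≤ ∑ u ∈ T.nbr c, y u} := by
    intro c
    refine convexHull_min ?_ ?_ (hx c)
    · rintro z ⟨hz, heven⟩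
      have h0 : ∀ v, 0 ≤ z v := fun v => by rcases hz v with h | h <;> simp [h]
      refine ⟨h0, fun v hv => ?_⟩
      rcases hz v with h | h
      · rw [h, mul_zero]
        exact Finset.sum_nonneg fun u _ => h0 u
      · have hset : {u : T.V | u ∈ T.nbr c ∧ z u = 1} =
            (((T.nbr c).filter fun u => z u = 1 : Finset T.V) : Set T.V) := by
          ext u; simp
        rw [hset, Set.ncard_coe_finset] at heven
        have hsum : ∑ u ∈ T.nbr c, z u = ((T.nbr c).filter fun u => z u = 1).card := by
          rw [Finset.card_filter]
          push_cast
          refine Finset.sum_congr rfl fun u _ => ?_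
          rcases hz u with h | h <;> simp [h]
        have hpos : 0 < ((T.nbr c).filter fun u => z u = 1).card :=
          Finset.card_pos.2 ⟨v, by simp [hv, h]⟩
        have htwo : 2 ≤ ((T.nbr c).filter fun u => z u = 1).card := by
          obtain ⟨r, hr⟩ := heven; omega
        rw [hsum, h, mul_one]
        exact_mod_cast htwo
    · intro y hy z hz a b ha hb _
      refine ⟨fun v => ?_, fun v hv => ?_⟩
      · have := mul_nonneg ha (hy.1 v)
        have := mul_nonneg hb (hz.1 v)
        simp only [Pi.add_apply, Pi.smul_apply, smul_eq_mul]
        linarith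
      · have h1 := mul_le_mul_of_nonneg_left (hy.2 v hv) ha
        have h2 := mul_le_mul_of_nonneg_left (hz.2 v hv) hb
        simp only [Pi.add_apply, Pi.smul_apply, smul_eq_mul, Finset.sum_add_distrib,
          ← Finset.mul_sum]
        linarith
  -- Nonnegativity needs at least one check: an empty intersection would be the whole space.
  exact ⟨(key (Classical.arbitrary _)).1, fun c => (key c).2⟩

theorem zero_mem_localCode (T : TannerGraph) (c : T.C) : (0 : T.V → ℝ) ∈ T.localCode c := by
  refine ⟨fun v => Or.inl rfl, ?_⟩
  simp

theorem finite_localCode (T : TannerGraph) (c : T.C) : (T.localCode c).Finite := by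
  refine Set.Finite.subset (Set.Finite.pi (ι := T.V) (t := fun _ => ({0, 1} : Set ℝ))
    fun _ => by simp) ?_
  rintro z ⟨hz, -⟩ v _
  simpa using hz v

theorem single_mem_localCode (T : TannerGraph) [DecidableEq T.V] (c : T.C) {v : T.V}
    (hv : v ∉ T.nbr c) : (Pi.single v 1 : T.V → ℝ) ∈ T.localCode c := by
  refine ⟨fun u => ?_, ?_⟩
  · by_cases h : u = v
    · subst h; simp
    · simp [h]
  · have : {u : T.V | u ∈ T.nbr c ∧ (Pi.single v 1 : T.V → ℝ) u = 1} = ∅ := by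
      ext u
      by_cases h : u = v
      · subst h; simp [hv]
      · simp [h]
    simp [this]

theorem single_add_single_mem_localCode (T : TannerGraph) [DecidableEq T.V] (c : T.C) {u v : T.V}
    (hu : u ∈ T.nbr c) (hv : v ∈ T.nbr c) (huv : u ≠ v) :
    (Pi.single u 1 + Pi.single v 1 : T.V → ℝ) ∈ T.localCode c := by
  have hval : ∀ w, (Pi.single u 1 + Pi.single v 1 : T.V → ℝ) w = if w = u ∨ w = v then 1 else 0 := by
    intro w
    by_cases h : w = u
    · subst h; simp [huv]
    · by_cases h' : w = v
      · subst h'; simp [h]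
      · simp [h, h']
  refine ⟨fun w => ?_, ?_⟩
  · rw [hval]; split_ifs <;> simp
  · have : {w : T.V | w ∈ T.nbr c ∧ (Pi.single u 1 + Pi.single v 1 : T.V → ℝ) w = 1} = {u, v} := by
      ext w
      simp only [hval, Set.mem_ofPred_eq, Set.mem_insert_iff, Set.mem_singleton_iff]
      constructor
      · rintro ⟨-, h⟩
        by_contra h'
        simp [h'] at h
      · intro h
        refine ⟨?_, by simp [h]⟩
        rcases h with rfl | rfl <;> assumption
    rw [this, Set.ncard_pair huv]
    exact even_two

/-- The vectors of small weight in the cone lie in the fundamental polytope. -/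
theorem mem_fundamentalPolytope_of_parityCone (T : TannerGraph) {x : T.V → ℝ}
    (hx : ParityCone T.nbr x) (hsum : ∑ v, x v ≤ 1) : x ∈ T.fundamentalPolytope := by
  classical
  refine Set.mem_iInter.2 fun c => ?_
  by_contra hmem
  -- Testing the separating functional on `0`, on unit vectors off the check and on pairs inside it
  -- already forces `f x ≤ s * ∑ v, x v ≤ s`.
  obtain ⟨f, s, hfs, hsx⟩ := geometric_hahn_banach_closed_point (convex_convexHull ℝ _)
    ((T.finite_localCode c).isClosed_convexHull (𝕜 := ℝ)) hmem
  have hf : ∀ z ∈ T.localCode c, f z < s := fun z hz => hfs z (subset_convexHull ℝ _ hz)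
  set g : T.V → ℝ := fun v => f (Pi.single v 1) with hg
  have hfx : f x = ∑ v, g v * x v := by
    conv_lhs => rw [← Finset.univ_sum_single x]
    rw [map_sum]
    refine Finset.sum_congr rfl fun v _ => ?_
    have : (Pi.single v (x v) : T.V → ℝ) = x v • Pi.single v 1 := by
      ext u
      by_cases h : u = v
      · subst h; simp
      · simp [h]
    rw [this, map_smul, smul_eq_mul, mul_comm]
  have hs : 0 < s := by simpa using hf 0 (T.zero_mem_localCode c)
  have hout : ∀ v, v ∉ T.nbr c → g v ≤ s := fun v hv => (hf _ (T.single_mem_localCode c hv)).le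
  have hin : ∀ u ∈ T.nbr c, ∀ v ∈ T.nbr c, u ≠ v → g u + g v ≤ s := fun u hu v hv huv => by
    have := hf _ (T.single_add_single_mem_localCode c hu hv huv)
    rw [map_add] at this
    exact this.le
  have hnbr : ∑ v ∈ T.nbr c, g v * x v ≤ s / 2 * ∑ v ∈ T.nbr c, x v := by
    -- By the pair bound at most one coefficient exceeds `s / 2`; its excess is absorbed because `x
    -- u` is at most the sum of the other coordinates at the check.
    by_cases hbig : ∃ u ∈ T.nbr c, s / 2 < g u
    · obtain ⟨u, hu, hgu⟩ := hbig
      have h1 := Finset.add_sum_erase _ (fun v => g v * x v) hu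
      have h2 := Finset.add_sum_erase _ x hu
      have h3 : ∑ v ∈ (T.nbr c).erase u, g v * x v ≤ (s - g u) * ∑ v ∈ (T.nbr c).erase u, x v := by
        rw [Finset.mul_sum]
        refine Finset.sum_le_sum fun v hv => ?_
        have := hin u hu v (Finset.mem_of_mem_erase hv) (Finset.ne_of_mem_erase hv).symm
        exact mul_le_mul_of_nonneg_right (by linarith) (hx.1 v)
      have h4 := hx.2 c u hu
      rw [← h1, ← h2] at *
      nlinarith
    · push Not at hbig
      rw [Finset.mul_sum]
      exact Finset.sum_le_sum fun v hv => mul_le_mul_of_nonneg_right (hbig v hv) (hx.1 v)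
  have hrest : ∑ v ∈ (T.nbr c)ᶜ, g v * x v ≤ s * ∑ v ∈ (T.nbr c)ᶜ, x v := by
    rw [Finset.mul_sum]
    exact Finset.sum_le_sum fun v hv =>
      mul_le_mul_of_nonneg_right (hout v (Finset.mem_compl.1 hv)) (hx.1 v)
  have h1 := Finset.sum_add_sum_compl (T.nbr c) fun v => g v * x v
  have h2 := Finset.sum_add_sum_compl (T.nbr c) x
  have h3 : 0 ≤ ∑ v ∈ T.nbr c, x v := Finset.sum_nonneg fun v _ => hx.1 v
  nlinarith

/-- LP decoding succeeds exactly when every nonzero vector of the cone has positive cost. -/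
theorem lpSuccess_iff (T : TannerGraph) [Nonempty T.C] (η : T.V → Bool) :
    T.LPSuccess η ↔
      ∀ x : T.V → ℝ, ParityCone T.nbr x → x ≠ 0 → 0 < ∑ v, bscSign (η v) * x v := by
  have hcost : ∀ x, T.lpCost η x = ∑ v, bscSign (η v) * x v := fun _ => rfl
  have h0 : (0 : T.V → ℝ) ∈ T.fundamentalPolytope :=
    T.mem_fundamentalPolytope_of_parityCone ⟨fun _ => le_rfl, by simp⟩ (by simp)
  have hc0 : T.lpCost η 0 = 0 := by simp [hcost]
  unfold LPSuccess
  constructor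
  · intro h x hx hne
    have hmin : IsMinOn (T.lpCost η) T.fundamentalPolytope 0 :=
      (h.symm ▸ Set.mem_singleton _ : (0 : T.V → ℝ) ∈ {x | x ∈ T.fundamentalPolytope ∧
        IsMinOn (T.lpCost η) T.fundamentalPolytope x}).2
    set t : ℝ := (1 + ∑ v, x v)⁻¹ with ht
    have hS : 0 ≤ ∑ v, x v := Finset.sum_nonneg fun v _ => hx.1 v
    have htpos : 0 < t := by positivity
    have htx : t • x ∈ T.fundamentalPolytope := by
      refine T.mem_fundamentalPolytope_of_parityCone
        ⟨fun v => mul_nonneg htpos.le (hx.1 v), fun c v hv => ?_⟩ ?_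
      · have := mul_le_mul_of_nonneg_left (hx.2 c v hv) htpos.le
        simp only [Pi.smul_apply, smul_eq_mul, ← Finset.mul_sum]
        linarith
      · simp only [Pi.smul_apply, smul_eq_mul, ← Finset.mul_sum]
        rw [ht, inv_mul_le_iff₀ (by positivity)]
        linarith
    have hctx : T.lpCost η (t • x) = t * ∑ v, bscSign (η v) * x v := by
      rw [hcost, Finset.mul_sum]
      refine Finset.sum_congr rfl fun v _ => ?_
      simp only [Pi.smul_apply, smul_eq_mul]; ring
    by_contra hle
    push Not at hle
    -- A rescaled cone vector of nonpositive cost would be a second minimizer.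
    have hmin' : IsMinOn (T.lpCost η) T.fundamentalPolytope (t • x) := by
      intro y hy
      have h1 : T.lpCost η 0 ≤ T.lpCost η y := hmin hy
      have h2 : t * ∑ v, bscSign (η v) * x v ≤ 0 :=
        mul_nonpos_of_nonneg_of_nonpos htpos.le hle
      show T.lpCost η (t • x) ≤ T.lpCost η y
      linarith
    have : t • x ∈ ({0} : Set (T.V → ℝ)) := h ▸ ⟨htx, hmin'⟩
    rcases smul_eq_zero.1 (Set.mem_singleton_iff.1 this) with h | h
    · exact htpos.ne' h
    · exact hne h
  · intro h
    have hpos : ∀ x ∈ T.fundamentalPolytope, x ≠ 0 → 0 < T.lpCost η x := fun x hx hne =>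
      h x (T.parityCone_of_mem_fundamentalPolytope hx) hne
    ext x
    simp only [Set.mem_ofPred_eq, Set.mem_singleton_iff]
    constructor
    · rintro ⟨hx, hmin⟩
      by_contra hne
      have h1 : T.lpCost η x ≤ T.lpCost η 0 := hmin h0
      have h2 := hpos x hx hne
      linarith
    · rintro rfl
      refine ⟨h0, fun y hy => ?_⟩
      show T.lpCost η 0 ≤ T.lpCost η y
      by_cases hy0 : y = 0
      · rw [hy0]
      · rw [hc0]; exact (hpos y hy hy0).le

end TannerGraph

/-! ### Expectations over independent bits -/

open Classical in
/-- The expectation of `F` under independent bits that are `true` with probability `ε`. -/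
noncomputable def bscExp {V : Type} [Fintype V] (ε : ℝ) (F : (V → Bool) → ℝ) : ℝ :=
  ∑ η : V → Bool, (∏ v, if η v then ε else 1 - ε) * F η

section bscExp

variable {V : Type} [Fintype V]

theorem bscExp_mono {ε : ℝ} (h0 : 0 ≤ ε) (h1 : ε ≤ 1) {F G : (V → Bool) → ℝ}
    (h : ∀ η, F η ≤ G η) : bscExp ε F ≤ bscExp ε G := by
  refine Finset.sum_le_sum fun η _ => mul_le_mul_of_nonneg_left (h η) ?_
  refine Finset.prod_nonneg fun v _ => ?_
  split_ifs <;> linarith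

theorem bscExp_nonneg {ε : ℝ} (h0 : 0 ≤ ε) (h1 : ε ≤ 1) {F : (V → Bool) → ℝ}
    (h : ∀ η, 0 ≤ F η) : 0 ≤ bscExp ε F := by
  refine Finset.sum_nonneg fun η _ => mul_nonneg ?_ (h η)
  refine Finset.prod_nonneg fun v _ => ?_
  split_ifs <;> linarith

theorem bscExp_sum {ι : Type*} (s : Finset ι) (ε : ℝ) (F : ι → (V → Bool) → ℝ) :
    bscExp ε (fun η => ∑ i ∈ s, F i η) = ∑ i ∈ s, bscExp ε (F i) := by
  simp only [bscExp, Finset.mul_sum]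
  exact Finset.sum_comm

theorem bscExp_const_mul (ε a : ℝ) (F : (V → Bool) → ℝ) :
    bscExp ε (fun η => a * F η) = a * bscExp ε F := by
  simp only [bscExp, Finset.mul_sum]
  exact Finset.sum_congr rfl fun η _ => by ring

theorem bscExp_prod (ε : ℝ) (g : V → Bool → ℝ) :
    bscExp ε (fun η => ∏ v, g v (η v)) = ∏ v, (ε * g v true + (1 - ε) * g v false) := by
  classical
  have : ∀ v, ε * g v true + (1 - ε) * g v false =
      ∑ b : Bool, (if b then ε else 1 - ε) * g v b := fun v => by simp
  simp only [this, Finset.prod_univ_sum, Fintype.piFinset_univ, Finset.prod_mul_distrib, bscExp]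

theorem bscExp_const (ε a : ℝ) : bscExp (V := V) ε (fun _ => a) = a := by
  have h := bscExp_prod (V := V) ε fun _ _ => 1
  have h' := bscExp_const_mul (V := V) ε a fun _ => 1
  simp only [Finset.prod_const_one, mul_one, add_sub_cancel] at h h'
  rw [h', h, mul_one]

theorem bscExp_add (ε : ℝ) (F G : (V → Bool) → ℝ) :
    bscExp ε (fun η => F η + G η) = bscExp ε F + bscExp ε G := by
  simp only [bscExp, mul_add, Finset.sum_add_distrib]

theorem bscExp_apply (ε : ℝ) (v : V) (g : Bool → ℝ) :
    bscExp ε (fun η => g (η v)) = ε * g true + (1 - ε) * g false := by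
  classical
  have h := bscExp_prod (V := V) ε fun u b => if u = v then g b else 1
  have h2 : ∀ u, ε * (if u = v then g true else 1) + (1 - ε) * (if u = v then g false else 1) =
      if u = v then ε * g true + (1 - ε) * g false else 1 := fun u => by
    split_ifs <;> ring
  simpa only [h2, Finset.prod_ite_eq', Finset.mem_univ, if_true] using h

/-- Flipping the zeros of a BSC error pattern independently with probability `β` gives another
BSC error pattern. -/
theorem bscExp_bscExp_or (ε β : ℝ) (F : (V → Bool) → ℝ) :
    bscExp ε (fun η => bscExp β fun ω => F fun v => η v || ω v) =
      bscExp (ε + (1 - ε) * β) F := by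
  classical
  -- Expanding `F` in point indicators, which are products over the bits, reduces the claim to
  -- `bscExp_prod`.
  have hF : ∀ η ω : V → Bool, F (fun v => η v || ω v) =
      ∑ ξ : V → Bool, F ξ * ∏ v, if ξ v = (η v || ω v) then (1 : ℝ) else 0 := by
    intro η ω
    rw [Finset.sum_eq_single fun v => η v || ω v]
    · simp
    · intro ξ _ hξ
      obtain ⟨v, hv⟩ := Function.ne_iff.1 hξ
      rw [Finset.prod_eq_zero (Finset.mem_univ v) (if_neg hv), mul_zero]
    · simp
  simp only [hF, bscExp_sum, bscExp_const_mul]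
  have hin : ∀ ξ η : V → Bool,
      bscExp β (fun ω => ∏ v, if ξ v = (η v || ω v) then (1 : ℝ) else 0) =
        ∏ v, (β * (if ξ v = (η v || true) then 1 else 0) +
          (1 - β) * (if ξ v = (η v || false) then 1 else 0)) := fun ξ η =>
    bscExp_prod β fun v b => if ξ v = (η v || b) then (1 : ℝ) else 0
  simp only [hin]
  have hout : ∀ ξ : V → Bool,
      bscExp ε (fun η => ∏ v, (β * (if ξ v = (η v || true) then 1 else 0) +
          (1 - β) * (if ξ v = (η v || false) then 1 else 0))) =
        ∏ v, if ξ v then ε + (1 - ε) * β else 1 - (ε + (1 - ε) * β) := fun ξ => by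
    rw [bscExp_prod ε fun v b => (β * (if ξ v = (b || true) then (1 : ℝ) else 0) +
          (1 - β) * (if ξ v = (b || false) then 1 else 0))]
    refine Finset.prod_congr rfl fun v _ => ?_
    cases ξ v
    · simp; ring
    · simp
  simp only [hout]
  exact Finset.sum_congr rfl fun ξ _ => mul_comm _ _

/-- Bits on which `F` does not depend can be dropped. -/
theorem bscExp_subtype (ε : ℝ) (p : V → Prop) [Fintype {v // p v}]
    (F : ({v // p v} → Bool) → ℝ) :
    bscExp ε (fun η : V → Bool => F fun v => η v.1) = bscExp ε F := by
  classical
  have hF : ∀ η : V → Bool, F (fun v => η v.1) =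
      ∑ ξ : {v // p v} → Bool, F ξ * ∏ v : V,
        if h : p v then (if ξ ⟨v, h⟩ = η v then (1 : ℝ) else 0) else 1 := by
    intro η
    rw [Finset.sum_eq_single fun v => η v.1]
    · simp
    · intro ξ _ hξ
      obtain ⟨v, hv⟩ := Function.ne_iff.1 hξ
      rw [Finset.prod_eq_zero (Finset.mem_univ v.1), mul_zero]
      rw [dif_pos v.2, if_neg hv]
    · simp
  simp only [hF, bscExp_sum, bscExp_const_mul]
  have hprod : ∀ ξ : {v // p v} → Bool,
      bscExp ε (fun η : V → Bool => ∏ v : V,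
        if h : p v then (if ξ ⟨v, h⟩ = η v then (1 : ℝ) else 0) else 1) =
        ∏ v, if ξ v then ε else 1 - ε := fun ξ => by
    rw [bscExp_prod ε fun v b => if h : p v then (if ξ ⟨v, h⟩ = b then (1 : ℝ) else 0) else 1]
    rw [← Fintype.prod_subtype_mul_prod_subtype p]
    have h1 : ∀ v : {v // ¬ p v}, ε * (if h : p v.1 then
          (if ξ ⟨v.1, h⟩ = true then (1 : ℝ) else 0) else 1) +
        (1 - ε) * (if h : p v.1 then (if ξ ⟨v.1, h⟩ = false then (1 : ℝ) else 0) else 1) = 1 :=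
      fun v => by simp [v.2]
    rw [Finset.prod_congr rfl fun v _ => h1 v, Finset.prod_const_one, mul_one]
    refine Finset.prod_congr (by ext; simp) fun v _ => ?_
    simp only [v.2, dif_pos]
    cases ξ v <;> simp
  simp only [hprod]
  exact Finset.sum_congr (by ext; simp) fun ξ _ => mul_comm _ _

end bscExp

open Classical in
theorem TannerGraph.lpErrorProb_eq (T : TannerGraph) (ε : ℝ) :
    T.lpErrorProb ε = bscExp ε fun η => if T.LPSuccess η then 0 else 1 := by
  unfold TannerGraph.lpErrorProb bscExp
  refine Finset.sum_congr rfl fun η _ => ?_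
  by_cases h : T.LPSuccess η <;> simp [h]

/-! ### Cutting a graph cover code and repairing cone vectors -/

namespace GraphCoverCode

variable {dv k L M : ℕ}

/-- The positions removed by the cut at `i`. -/
def IsCut (dv : ℕ) {L : ℕ} (i p : ZMod (2 * L + 1)) : Prop :=
  ∃ j ∈ Finset.range (2 * ((dv - 1) / 2)), p = i + (j : ZMod (2 * L + 1))

/-- A zone of positions that contains the cut at `i` and the window of every check node that
sees a removed position. -/
def NearCut (dv : ℕ) {L : ℕ} (i p : ZMod (2 * L + 1)) : Prop :=
  ∃ j ∈ Finset.Icc (-(dv : ℤ)) (2 * dv), p = i + (j : ZMod (2 * L + 1))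

theorem IsCut.nearCut {i p : ZMod (2 * L + 1)} (h : IsCut dv i p) : NearCut dv i p := by
  obtain ⟨j, hj, rfl⟩ := h
  refine ⟨j, ?_, by simp⟩
  simp only [Finset.mem_range, Finset.mem_Icc] at *
  omega

theorem toTanner_lpSuccess_iff (ζ : GraphCoverCode dv k L M) (hM : 0 < M / k)
    (η : ZMod (2 * L + 1) × Fin M → Bool) :
    ζ.toTanner.LPSuccess η ↔
      ∀ x, ParityCone ζ.nbr x → x ≠ 0 → 0 < ∑ v, bscSign (η v) * x v := by
  have : Nonempty ζ.toTanner.C := ⟨((0 : ZMod (2 * L + 1)), (⟨0, hM⟩ : Fin (M / k)))⟩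
  exact ζ.toTanner.lpSuccess_iff η

/-- LP decoding of a cut code concerns the vectors of the cone of the graph cover code that
vanish on the removed nodes. -/
theorem cut_lpSuccess_iff (ζ : GraphCoverCode dv k L M) (hM : 0 < M / k)
    (i : ZMod (2 * L + 1)) (η : ZMod (2 * L + 1) × Fin M → Bool) :
    (ζ.cut i).LPSuccess (fun v => η v.1) ↔
      ∀ x, ParityCone ζ.nbr x → (∀ v, IsCut dv i v.1 → x v = 0) → x ≠ 0 →
        0 < ∑ v, bscSign (η v) * x v := by
  classical
  have : Nonempty (ζ.cut i).C := ⟨((0 : ZMod (2 * L + 1)), (⟨0, hM⟩ : Fin (M / k)))⟩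
  have hkeep : ∀ v : ZMod (2 * L + 1) × Fin M,
      (∀ j ∈ Finset.range (2 * ((dv - 1) / 2)), v.1 ≠ i + (j : ZMod (2 * L + 1))) ↔
        ¬ IsCut dv i v.1 := fun v => by simp [IsCut]
  have hcone : ∀ x : ZMod (2 * L + 1) × Fin M → ℝ, (∀ v, IsCut dv i v.1 → x v = 0) →
      (ParityCone (ζ.cut i).nbr (fun v => x v.1) ↔ ParityCone ζ.nbr x) := by
    intro x hx
    have hsum : ∀ c, ∑ u ∈ (ζ.cut i).nbr c, x u.1 = ∑ u ∈ ζ.nbr c, x u := by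
      intro c
      refine (Finset.sum_subtype_eq_sum_filter x).trans (Finset.sum_filter_of_ne fun v _ hv => ?_)
      exact (hkeep v).2 fun h => hv (hx v h)
    constructor
    · rintro ⟨h0, hc⟩
      have h0' : ∀ v, 0 ≤ x v := fun v => by
        by_cases h : IsCut dv i v.1
        · rw [hx v h]
        · exact h0 ⟨v, (hkeep v).2 h⟩
      refine ⟨h0', fun c v hv => ?_⟩
      by_cases h : IsCut dv i v.1
      · rw [hx v h, mul_zero]
        exact Finset.sum_nonneg fun u _ => h0' u
      · exact (hc c ⟨v, (hkeep v).2 h⟩ (Finset.mem_subtype.2 hv)).trans_eq (hsum c)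
    · rintro ⟨h0, hc⟩
      refine ⟨fun v => h0 v.1, fun c v hv => ?_⟩
      rw [hsum]
      exact hc c v.1 (Finset.mem_subtype.1 hv)
  have hcost : ∀ x : ZMod (2 * L + 1) × Fin M → ℝ, (∀ v, IsCut dv i v.1 → x v = 0) →
      ∑ v : (ζ.cut i).V, bscSign (η v.1) * x v.1 = ∑ v, bscSign (η v) * x v := by
    intro x hx
    refine Eq.trans ?_ (Finset.sum_filter_of_ne (p := fun v => ∀ j ∈ Finset.range
      (2 * ((dv - 1) / 2)), v.1 ≠ i + (j : ZMod (2 * L + 1))) fun v _ hv => ?_)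
    · exact (Finset.sum_subtype _ (by simp) fun v => bscSign (η v) * x v).symm
    · exact (hkeep v).2 fun h => hv (by rw [hx v h, mul_zero])
  rw [TannerGraph.lpSuccess_iff]
  constructor
  · intro h x hx hcut hne
    rw [← hcost x hcut]
    refine h _ ((hcone x hcut).2 hx) fun h0 => hne ?_
    ext v
    by_cases hv : IsCut dv i v.1
    · exact hcut v hv
    · exact congrFun h0 ⟨v, (hkeep v).2 hv⟩
  · intro h y hy hne
    let x : ZMod (2 * L + 1) × Fin M → ℝ := fun v =>
      if hv : IsCut dv i v.1 then 0 else y ⟨v, (hkeep v).2 hv⟩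
    have hcut : ∀ v, IsCut dv i v.1 → x v = 0 := fun v hv => dif_pos hv
    have hxy : (fun v : (ζ.cut i).V => x v.1) = y := by
      ext v
      exact dif_neg ((hkeep v.1).1 v.2)
    have h1 := h x ((hcone x hcut).1 (hxy.symm ▸ hy)) hcut fun h0 => hne (by rw [← hxy, h0]; rfl)
    rw [← hcost x hcut] at h1
    exact h1.trans_eq (Finset.sum_congr rfl fun v _ => congrArg (_ * ·) (congrFun hxy v))

theorem cut_lpSuccess_of_toTanner (ζ : GraphCoverCode dv k L M) (hM : 0 < M / k)
    (i : ZMod (2 * L + 1)) {η : ZMod (2 * L + 1) × Fin M → Bool}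
    (h : ζ.toTanner.LPSuccess η) : (ζ.cut i).LPSuccess (fun v => η v.1) :=
  (ζ.cut_lpSuccess_iff hM i η).2 fun x hx _ =>
    (ζ.toTanner_lpSuccess_iff hM η).1 h x hx

open Classical in
/-- The total weight of `x` in the zone around the cut at `i`. -/
noncomputable def nearWeight (dv : ℕ) (x : ZMod (2 * L + 1) × Fin M → ℝ)
    (i : ZMod (2 * L + 1)) : ℝ :=
  ∑ v, if NearCut dv i v.1 then x v else 0

open Classical in
/-- Make `x` vanish on the cut, and make it constant in the rest of the zone around the cut. -/
noncomputable def repair (dv : ℕ) (x : ZMod (2 * L + 1) × Fin M → ℝ)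
    (i : ZMod (2 * L + 1)) (v : ZMod (2 * L + 1) × Fin M) : ℝ :=
  if IsCut dv i v.1 then 0 else if NearCut dv i v.1 then nearWeight dv x i else x v

theorem nearWeight_nonneg {x : ZMod (2 * L + 1) × Fin M → ℝ} (hx : ∀ v, 0 ≤ x v)
    (i : ZMod (2 * L + 1)) : 0 ≤ nearWeight dv x i :=
  Finset.sum_nonneg fun v _ => by split_ifs <;> simp [hx]

theorem le_nearWeight {x : ZMod (2 * L + 1) × Fin M → ℝ} (hx : ∀ v, 0 ≤ x v)
    {i : ZMod (2 * L + 1)} {v : ZMod (2 * L + 1) × Fin M} (h : NearCut dv i v.1) :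
    x v ≤ nearWeight dv x i := by
  classical
  have := Finset.single_le_sum (f := fun v => if NearCut dv i v.1 then x v else 0)
    (fun v _ => by split_ifs <;> simp [hx]) (Finset.mem_univ v)
  simpa [h, nearWeight] using this

/-- In the zone off the cut, a node shares each of its checks with another node at the same
position, hence of the same value, which settles its inequality. Outside the zone, the node's checks
see no cut node, and the other values can only have grown. -/
theorem parityCone_repair (ζ : GraphCoverCode dv k L M) (hk : 2 ≤ k)
    {x : ZMod (2 * L + 1) × Fin M → ℝ} (hx : ParityCone ζ.nbr x) (i : ZMod (2 * L + 1)) :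
    ParityCone ζ.nbr (repair dv x i) := by
  classical
  have h0 : ∀ v, 0 ≤ repair dv x i v := fun v => by
    unfold repair
    split_ifs
    exacts [le_rfl, nearWeight_nonneg hx.1 i, hx.1 v]
  refine ⟨h0, fun c v hv => ?_⟩
  by_cases hcut : IsCut dv i v.1
  · have : repair dv x i v = 0 := if_pos hcut
    rw [this, mul_zero]
    exact Finset.sum_nonneg fun u _ => h0 u
  by_cases hnear : NearCut dv i v.1
  · obtain ⟨a, ha, hva⟩ := ζ.window c v hv
    have hcard := ζ.card_window c a ha
    obtain ⟨u, hu, huv⟩ := Finset.exists_mem_ne (by omega) v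
      (s := (ζ.nbr c).filter fun v => v.1 = c.1 + (a : ZMod (2 * L + 1)))
    obtain ⟨huc, hua⟩ := Finset.mem_filter.1 hu
    have hpos : u.1 = v.1 := hua.trans hva.symm
    have hval : repair dv x i u = repair dv x i v := by
      simp only [repair, hpos, if_neg hcut, if_pos hnear]
    calc 2 * repair dv x i v = ∑ w ∈ {u, v}, repair dv x i w := by
          rw [Finset.sum_pair huv, hval, two_mul]
      _ ≤ _ := Finset.sum_le_sum_of_subset_of_nonneg
          (by intro w; simp only [Finset.mem_insert, Finset.mem_singleton]
              rintro (rfl | rfl) <;> assumption) fun w _ _ => h0 w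
  · have hval : repair dv x i v = x v := by simp only [repair, if_neg hcut, if_neg hnear]
    rw [hval]
    refine (hx.2 c v hv).trans (Finset.sum_le_sum fun u hu => ?_)
    have hucut : ¬ IsCut dv i u.1 := by
      rintro ⟨j, hj, hui⟩
      obtain ⟨a, ha, hva⟩ := ζ.window c v hv
      obtain ⟨b, hb, hub⟩ := ζ.window c u hu
      -- A check seeing both nodes puts them at distance at most `dv - 1`, so `v` would lie in the
      -- zone.
      refine hnear ⟨j + a - b, ?_, ?_⟩
      · simp only [Finset.mem_range, Finset.mem_Icc] at *
        omega
      · have hc : c.1 = i + (j : ZMod (2 * L + 1)) - (b : ZMod (2 * L + 1)) := by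
          rw [← hui, hub]; ring
        rw [hva, hc]
        push_cast
        ring
    unfold repair
    rw [if_neg hucut]
    split_ifs with h
    exacts [le_nearWeight hx.1 h, le_rfl]

open Classical in
theorem card_nearCut_left_le (p : ZMod (2 * L + 1)) :
    (Finset.univ.filter fun i => NearCut dv i p).card ≤ 3 * dv + 1 := by
  have hsub : (Finset.univ.filter fun i => NearCut dv i p) ⊆
      (Finset.Icc (-(dv : ℤ)) (2 * dv)).image fun j : ℤ => p - (j : ZMod (2 * L + 1)) := by
    intro i hi
    obtain ⟨j, hj, h⟩ := (Finset.mem_filter.1 hi).2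
    exact Finset.mem_image.2 ⟨j, hj, by rw [h]; ring⟩
  refine (Finset.card_le_card hsub).trans (Finset.card_image_le.trans ?_)
  rw [Int.card_Icc]
  omega

open Classical in
theorem card_nearCut_right_le (i : ZMod (2 * L + 1)) :
    (Finset.univ.filter fun v : ZMod (2 * L + 1) × Fin M => NearCut dv i v.1).card ≤
      (3 * dv + 1) * M := by
  have hsub : (Finset.univ.filter fun v : ZMod (2 * L + 1) × Fin M => NearCut dv i v.1) ⊆
      ((Finset.Icc (-(dv : ℤ)) (2 * dv)).image fun j : ℤ => i + (j : ZMod (2 * L + 1))) ×ˢ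
        Finset.univ := by
    intro v hv
    obtain ⟨j, hj, h⟩ := (Finset.mem_filter.1 hv).2
    exact Finset.mem_product.2 ⟨Finset.mem_image.2 ⟨j, hj, h.symm⟩, Finset.mem_univ _⟩
  refine (Finset.card_le_card hsub).trans ?_
  rw [Finset.card_product, Finset.card_univ, Fintype.card_fin]
  refine Nat.mul_le_mul_right _ (Finset.card_image_le.trans ?_)
  rw [Int.card_Icc]
  omega

/-- Double counting: each node lies in the zones of at most `3 * dv + 1` cuts. -/
theorem sum_nearWeight_le {x : ZMod (2 * L + 1) × Fin M → ℝ} (hx : ∀ v, 0 ≤ x v) :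
    ∑ i, nearWeight dv x i ≤ (3 * dv + 1) * ∑ v, x v := by
  classical
  unfold nearWeight
  rw [Finset.sum_comm, Finset.mul_sum]
  refine Finset.sum_le_sum fun v _ => ?_
  rw [← Finset.sum_filter, Finset.sum_const, nsmul_eq_mul]
  refine mul_le_mul_of_nonneg_right ?_ (hx v)
  exact_mod_cast card_nearCut_left_le v.1

/-- Only nodes of the zone change, each by at most the zone's weight. -/
theorem sum_abs_sub_repair_le {x : ZMod (2 * L + 1) × Fin M → ℝ} (hx : ∀ v, 0 ≤ x v)
    (i : ZMod (2 * L + 1)) :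
    ∑ v, |x v - repair dv x i v| ≤ (3 * dv + 1) * M * nearWeight dv x i := by
  classical
  have hW := nearWeight_nonneg (dv := dv) hx i
  have hle : ∀ v, |x v - repair dv x i v| ≤ if NearCut dv i v.1 then nearWeight dv x i else 0 := by
    intro v
    unfold repair
    split_ifs with h1 h2 h2
    · rw [sub_zero, abs_of_nonneg (hx v)]
      exact le_nearWeight hx h2
    · exact absurd h1.nearCut h2
    · have := le_nearWeight hx h2
      have := hx v
      rw [abs_le]; constructor <;> linarith
    · simp
  refine (Finset.sum_le_sum fun v _ => hle v).trans ?_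
  rw [← Finset.sum_filter, Finset.sum_const, nsmul_eq_mul]
  refine mul_le_mul_of_nonneg_right ?_ hW
  exact_mod_cast card_nearCut_right_le i

open Classical in
/-- If most of the cut codes are decoded correctly, then no vector of the cone of the graph cover
code has a very negative cost. -/
theorem cost_ge (ζ : GraphCoverCode dv k L M) (hk : 2 ≤ k) (hM : 0 < M / k)
    (η : ZMod (2 * L + 1) × Fin M → Bool) {x : ZMod (2 * L + 1) × Fin M → ℝ}
    (hx : ParityCone ζ.nbr x) :
    -(((2 * L + 1 : ℝ)⁻¹ * ∑ i, if (ζ.cut i).LPSuccess (fun v => η v.1) then (0 : ℝ) else 1) +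
        (3 * dv + 1) ^ 2 * M / (2 * L + 1)) * ∑ v, x v ≤
      ∑ v, bscSign (η v) * x v := by
  set S := ∑ v, x v with hS
  set cost := ∑ v, bscSign (η v) * x v with hcost
  have hdiff : ∀ y : ZMod (2 * L + 1) × Fin M → ℝ,
      ∑ v, bscSign (η v) * y v - ∑ v, |x v - y v| ≤ cost := by
    intro y
    rw [← Finset.sum_sub_distrib]
    refine Finset.sum_le_sum fun v _ => ?_
    have h1 : |bscSign (η v) * (x v - y v)| = |x v - y v| := by
      rw [abs_mul, abs_bscSign, one_mul]
    have h2 := neg_abs_le (bscSign (η v) * (x v - y v))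
    rw [h1] at h2
    linarith
  -- A successful cut gives its repaired vector nonnegative cost; at a failing cut the trivial bound
  -- `-S` is used. The claim is the average of these bounds over `i`.
  have hone : ∀ i, -(if (ζ.cut i).LPSuccess (fun v => η v.1) then (0 : ℝ) else 1) * S -
      (3 * dv + 1) * M * nearWeight dv x i ≤ cost := by
    intro i
    have hW := nearWeight_nonneg (dv := dv) hx.1 i
    split_ifs with h
    · have hr : 0 ≤ ∑ v, bscSign (η v) * repair dv x i v := by
        by_cases h0 : repair dv x i = 0
        · simp [h0]
        · exact ((ζ.cut_lpSuccess_iff hM i η).1 h _ (ζ.parityCone_repair hk hx i)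
            (fun v hv => if_pos hv) h0).le
      have := hdiff (repair dv x i)
      have := sum_abs_sub_repair_le (dv := dv) hx.1 i
      linarith
    · have h1 := hdiff 0
      have h2 : ∑ v, |x v - (0 : ZMod (2 * L + 1) × Fin M → ℝ) v| = S :=
        Finset.sum_congr rfl fun v _ => by simp [abs_of_nonneg (hx.1 v)]
      rw [h2] at h1
      simp only [Pi.zero_apply, mul_zero, Finset.sum_const_zero] at h1
      have : 0 ≤ (3 * dv + 1) * M * nearWeight dv x i := by positivity
      linarith
  have hsum := Finset.sum_le_sum fun i (_ : i ∈ Finset.univ) => hone i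
  rw [Finset.sum_sub_distrib, ← Finset.sum_mul, Finset.sum_neg_distrib, ← Finset.mul_sum,
    Finset.sum_const, Finset.card_univ, ZMod.card, nsmul_eq_mul] at hsum
  push_cast at hsum
  have hN : (0 : ℝ) < 2 * L + 1 := by positivity
  have hnear := mul_le_mul_of_nonneg_left (sum_nearWeight_le (dv := dv) hx.1)
    (by positivity : (0 : ℝ) ≤ (3 * dv + 1) * M)
  rw [← mul_le_mul_iff_right₀ hN]
  refine le_trans (le_of_eq ?_) ((sub_le_sub_left hnear _).trans hsum)
  rw [← hS]
  field_simp
  ring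

/-! ### Comparing error probabilities of a cover and its cuts -/

open Classical in
theorem lpErrorProb_cut_le (ζ : GraphCoverCode dv k L M) (hM : 0 < M / k)
    (i : ZMod (2 * L + 1)) {ε : ℝ} (h0 : 0 ≤ ε) (h1 : ε ≤ 1) :
    (ζ.cut i).lpErrorProb ε ≤ ζ.toTanner.lpErrorProb ε := by
  rw [TannerGraph.lpErrorProb_eq, TannerGraph.lpErrorProb_eq]
  refine ((bscExp_subtype ε _ fun η => if (ζ.cut i).LPSuccess η then 0 else 1).symm.trans_le
    (bscExp_mono (V := ZMod (2 * L + 1) × Fin M) h0 h1 fun η => ?_))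
  by_cases h : ζ.toTanner.LPSuccess η
  · have := ζ.cut_lpSuccess_of_toTanner hM i h
    refine (if_pos this).le.trans ?_
    rw [if_pos h]
  · rw [if_neg h]
    split_ifs <;> norm_num

open Classical in
/-- The LP error probability of a graph cover code at a crossover probability is controlled by the
average LP error probability of its cut codes at a larger crossover probability. -/
theorem lpErrorProb_toTanner_mul_le (ζ : GraphCoverCode dv k L M) (hk : 2 ≤ k) (hM : 0 < M / k)
    {ε β : ℝ} (hε0 : 0 ≤ ε) (hε1 : ε ≤ 1) (hβ0 : 0 ≤ β) (hβ1 : β < 1) :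
    ζ.toTanner.lpErrorProb ε * (β - (3 * dv + 1) ^ 2 * M / (2 * L + 1)) ≤
      (2 * L + 1 : ℝ)⁻¹ * ∑ i, (ζ.cut i).lpErrorProb (ε + (1 - ε) * β) := by
  set K : ℝ := (3 * dv + 1) ^ 2 * M / (2 * L + 1) with hK
  obtain ⟨f, hf⟩ : ∃ f : (ZMod (2 * L + 1) × Fin M → Bool) → ℝ, f = fun η =>
      (2 * L + 1 : ℝ)⁻¹ * ∑ i, if (ζ.cut i).LPSuccess (fun v => η v.1) then (0 : ℝ) else 1 :=
    ⟨_, rfl⟩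
  have hf0 : ∀ η, 0 ≤ f η := fun η => by
    rw [hf]
    exact mul_nonneg (by positivity)
      (Finset.sum_nonneg fun i _ => by split_ifs <;> norm_num)
  have hright : (2 * L + 1 : ℝ)⁻¹ * ∑ i, (ζ.cut i).lpErrorProb (ε + (1 - ε) * β) =
      bscExp (ε + (1 - ε) * β) f := by
    rw [hf, bscExp_const_mul, bscExp_sum]
    congr 1
    refine Finset.sum_congr rfl fun i _ => ?_
    rw [TannerGraph.lpErrorProb_eq]
    exact (bscExp_subtype _ _ fun η => if (ζ.cut i).LPSuccess η then 0 else 1).symm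
  rw [hright, ← bscExp_bscExp_or, TannerGraph.lpErrorProb_eq, mul_comm, ← bscExp_const_mul]
  refine bscExp_mono (V := ZMod (2 * L + 1) × Fin M) hε0 hε1 fun η => ?_
  have hg0 : 0 ≤ bscExp β fun ω => f fun v => η v || ω v :=
    bscExp_nonneg hβ0 hβ1.le fun ω => hf0 _
  by_cases hsucc : ζ.toTanner.LPSuccess η
  · rw [if_pos hsucc, mul_zero]; exact hg0
  rw [if_neg hsucc, mul_one]
  by_contra hlt
  push Not at hlt
  refine hsucc ((ζ.toTanner_lpSuccess_iff hM η).2 fun x hx hne => ?_)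
  have hS : 0 < ∑ v, x v := by
    obtain ⟨v, hv⟩ := Function.ne_iff.1 hne
    exact Finset.sum_pos' (fun v _ => hx.1 v)
      ⟨v, Finset.mem_univ v, lt_of_le_of_ne (hx.1 v) (Ne.symm hv)⟩
  -- The vector `x` is fixed before the extra flips are averaged, so no union bound over cone
  -- vectors is needed.
  have hexp : bscExp β (fun ω => -(f (fun v => η v || ω v) + K) * ∑ v, x v) ≤
      bscExp β (fun ω => ∑ v, bscSign (η v || ω v) * x v) :=
    bscExp_mono hβ0 hβ1.le fun ω => by
      rw [hf]
      exact ζ.cost_ge hk hM (fun v => η v || ω v) hx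
  have hl : bscExp β (fun ω => -(f (fun v => η v || ω v) + K) * ∑ v, x v) =
      -((bscExp β fun ω => f fun v => η v || ω v) + K) * ∑ v, x v := by
    have : (fun ω : ZMod (2 * L + 1) × Fin M → Bool =>
        -(f (fun v => η v || ω v) + K) * ∑ v, x v) =
        fun ω => (-∑ v, x v) * (f (fun v => η v || ω v) + K) := by
      ext ω; ring
    rw [this, bscExp_const_mul, bscExp_add, bscExp_const]
    ring
  -- For either value of the bit, the mean sign after the flips is `(1 - β) * bscSign (η v) - β`.
  have hr : bscExp β (fun ω => ∑ v, bscSign (η v || ω v) * x v) =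
      (1 - β) * ∑ v, bscSign (η v) * x v - β * ∑ v, x v := by
    rw [bscExp_sum, Finset.mul_sum, Finset.mul_sum, ← Finset.sum_sub_distrib]
    refine Finset.sum_congr rfl fun v _ => ?_
    rw [bscExp_apply β v fun b => bscSign (η v || b) * x v]
    cases η v <;> simp [bscSign] <;> ring
  have hmain := (hl.symm.trans_le hexp).trans_eq hr
  have hpos : 0 < (1 - β) * ∑ v, bscSign (η v) * x v := by nlinarith
  exact (mul_pos_iff_of_pos_left (by linarith)).1 hpos

end GraphCoverCode

/-! ### Averaging over the ensembles -/

open Filter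

instance GraphCoverCode.instFinite {dv k L M : ℕ} : Finite (GraphCoverCode dv k L M) := by
  refine Finite.of_injective GraphCoverCode.nbr ?_
  rintro ⟨n, _, _, _⟩ ⟨n', _, _, _⟩ h
  cases h
  rfl

theorem PMF.tsum_map_toReal_mul {α : Type*} {β : Type*} [Fintype α] (p : PMF α) (f : α → β)
    (g : β → ℝ) : ∑' b, ((p.map f) b).toReal * g b = ∑ a, (p a).toReal * g (f a) := by
  classical
  have hval : ∀ b, ((p.map f) b).toReal = ∑ a, if b = f a then (p a).toReal else 0 := by
    intro b
    rw [PMF.map_apply, tsum_fintype, ENNReal.toReal_sum]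
    · refine Finset.sum_congr rfl fun a _ => ?_
      split_ifs <;> simp
    · intro a _
      split_ifs
      exacts [p.apply_ne_top a, ENNReal.zero_ne_top]
  rw [tsum_eq_sum (s := Finset.univ.image f)]
  · simp only [hval, Finset.sum_mul]
    rw [Finset.sum_comm]
    refine Finset.sum_congr rfl fun a _ => ?_
    rw [Finset.sum_eq_single (f a)]
    · simp
    · intro b _ hb
      simp [hb]
    · simp
  · intro b hb
    rw [hval, Finset.sum_eq_zero, zero_mul]
    intro a _
    rw [if_neg]
    rintro rfl
    exact hb (Finset.mem_image_of_mem f (Finset.mem_univ a))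

section Ensemble

variable {dv k L M : ℕ} [Fintype (GraphCoverCode dv k L M)]

theorem ensembleErrorProb_coverEnsemble (Γ : PMF (GraphCoverCode dv k L M)) (ε : ℝ) :
    ensembleErrorProb (coverEnsemble Γ) ε = ∑ ζ, (Γ ζ).toReal * ζ.toTanner.lpErrorProb ε :=
  PMF.tsum_map_toReal_mul Γ _ _

theorem ensembleErrorProb_coupledEnsemble (Γ : PMF (GraphCoverCode dv k L M)) (ε : ℝ) :
    ensembleErrorProb (coupledEnsemble Γ) ε =
      ∑ ζ, (Γ ζ).toReal * ((2 * L + 1 : ℝ)⁻¹ * ∑ i, (ζ.cut i).lpErrorProb ε) := by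
  classical
  -- Sampling the pair of code and cut on a finite type turns the sum over all Tanner graphs into a
  -- finite one.
  let q : PMF (GraphCoverCode dv k L M × ZMod (2 * L + 1)) :=
    Γ.bind fun ζ => (PMF.uniformOfFintype (ZMod (2 * L + 1))).map fun i => (ζ, i)
  have hq : coupledEnsemble Γ = q.map fun a => a.1.cut a.2 := by
    simp only [q, coupledEnsemble, PMF.map_bind, PMF.map_comp]
    rfl
  have hqval : ∀ ζ i, (q (ζ, i)).toReal = (Γ ζ).toReal * (2 * L + 1 : ℝ)⁻¹ := by
    intro ζ i
    have : q (ζ, i) = Γ ζ * ((2 * L + 1 : ℕ) : ENNReal)⁻¹ := by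
      simp only [q, PMF.bind_apply, PMF.map_apply, PMF.uniformOfFintype_apply, ZMod.card]
      rw [tsum_eq_single ζ, tsum_eq_single i]
      · simp
      · intro j hj
        simp [hj.symm]
      · intro ξ hξ
        simp [hξ.symm]
    rw [this, ENNReal.toReal_mul, ENNReal.toReal_inv, ENNReal.toReal_natCast]
    push_cast
    rfl
  unfold ensembleErrorProb
  rw [hq]
  refine (PMF.tsum_map_toReal_mul q _ fun T : TannerGraph => T.lpErrorProb ε).trans ?_
  rw [Fintype.sum_prod_type]
  refine Finset.sum_congr rfl fun ζ _ => ?_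
  simp only [hqval, Finset.mul_sum, mul_assoc]

end Ensemble

theorem TannerGraph.lpErrorProb_nonneg (T : TannerGraph) {ε : ℝ} (h0 : 0 ≤ ε) (h1 : ε ≤ 1) :
    0 ≤ T.lpErrorProb ε := by
  classical
  refine Finset.sum_nonneg fun η _ => ?_
  split_ifs
  · exact le_rfl
  · exact Finset.prod_nonneg fun v _ => by split_ifs <;> linarith

theorem ensembleErrorProb_nonneg (Γ : PMF TannerGraph) {ε : ℝ} (h0 : 0 ≤ ε) (h1 : ε ≤ 1) :
    0 ≤ ensembleErrorProb Γ ε :=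
  tsum_nonneg fun T => mul_nonneg ENNReal.toReal_nonneg (T.lpErrorProb_nonneg h0 h1)

theorem ensembleErrorProb_coupledEnsemble_le {dv k L M : ℕ} (hM : 0 < M / k)
    (Γ : PMF (GraphCoverCode dv k L M)) {ε : ℝ} (h0 : 0 ≤ ε) (h1 : ε ≤ 1) :
    ensembleErrorProb (coupledEnsemble Γ) ε ≤ ensembleErrorProb (coverEnsemble Γ) ε := by
  have := Fintype.ofFinite (GraphCoverCode dv k L M)
  rw [ensembleErrorProb_coverEnsemble, ensembleErrorProb_coupledEnsemble]
  refine Finset.sum_le_sum fun ζ _ => mul_le_mul_of_nonneg_left ?_ ENNReal.toReal_nonneg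
  rw [inv_mul_le_iff₀ (by positivity)]
  refine (Finset.sum_le_card_nsmul _ _ _ fun i _ => ζ.lpErrorProb_cut_le hM i h0 h1).trans ?_
  rw [Finset.card_univ, ZMod.card, nsmul_eq_mul]
  push_cast
  exact le_rfl

theorem ensembleErrorProb_coverEnsemble_mul_le {dv k L M : ℕ} (hk : 2 ≤ k) (hM : 0 < M / k)
    (Γ : PMF (GraphCoverCode dv k L M)) {ε β : ℝ} (hε0 : 0 ≤ ε) (hε1 : ε ≤ 1) (hβ0 : 0 ≤ β)
    (hβ1 : β < 1) :
    ensembleErrorProb (coverEnsemble Γ) ε * (β - (3 * dv + 1) ^ 2 * M / (2 * L + 1)) ≤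
      ensembleErrorProb (coupledEnsemble Γ) (ε + (1 - ε) * β) := by
  have := Fintype.ofFinite (GraphCoverCode dv k L M)
  rw [ensembleErrorProb_coverEnsemble, ensembleErrorProb_coupledEnsemble, Finset.sum_mul]
  refine Finset.sum_le_sum fun ζ _ => ?_
  rw [mul_assoc]
  exact mul_le_mul_of_nonneg_left (ζ.lpErrorProb_toTanner_mul_le hk hM hε0 hε1 hβ0 hβ1)
    ENNReal.toReal_nonneg

/-! ### Comparison of thresholds -/

/-- Below a crossover probability at which the cut codes are decoded with vanishing error, so are
the graph cover codes. -/
theorem tendsto_coverEnsemble_of_coupledEnsemble {dv k : ℕ} (hk : 2 ≤ k) {L M : ℕ → ℕ}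
    (Γ : ∀ t, PMF (GraphCoverCode dv k (L t) (M t))) (hMk : ∀ t, 0 < M t / k)
    (hML : (fun t => (M t : ℝ)) =o[atTop] fun t => (L t : ℝ)) {ε ε' : ℝ}
    (h0 : 0 ≤ ε') (hlt : ε' < ε) (h1 : ε < 1)
    (h : Tendsto (fun t => ensembleErrorProb (coupledEnsemble (Γ t)) ε) atTop (nhds 0)) :
    Tendsto (fun t => ensembleErrorProb (coverEnsemble (Γ t)) ε') atTop (nhds 0) := by
  -- The flip probability that degrades crossover probability `ε'` to exactly `ε`.
  set β : ℝ := (ε - ε') / (1 - ε') with hβ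
  have hd : 0 < 1 - ε' := by linarith
  have hβ0 : 0 < β := div_pos (by linarith) hd
  have hβ1 : β < 1 := by rw [hβ, div_lt_one hd]; linarith
  have hεβ : ε' + (1 - ε') * β = ε := by rw [hβ]; field_simp; ring
  have hD : (0 : ℝ) < (3 * dv + 1) ^ 2 := by positivity
  have hgap : ∀ᶠ t in atTop, β / 2 ≤ β - (3 * dv + 1) ^ 2 * M t / (2 * L t + 1) := by
    filter_upwards [hML.def (show (0 : ℝ) < β / (2 * (3 * dv + 1) ^ 2) by positivity)] with t ht
    rw [Real.norm_natCast, Real.norm_natCast, div_mul_eq_mul_div,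
      le_div_iff₀ (by positivity)] at ht
    have hL : (0 : ℝ) ≤ L t := Nat.cast_nonneg _
    have : (3 * dv + 1) ^ 2 * (M t : ℝ) / (2 * L t + 1) ≤ β / 2 := by
      rw [div_le_iff₀ (by positivity)]
      nlinarith
    linarith
  have hbound : ∀ᶠ t in atTop, ensembleErrorProb (coverEnsemble (Γ t)) ε' ≤
      2 / β * ensembleErrorProb (coupledEnsemble (Γ t)) ε := by
    filter_upwards [hgap] with t ht
    have h2 := ensembleErrorProb_coverEnsemble_mul_le hk (hMk t) (Γ t) h0 (by linarith) hβ0.le hβ1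
    rw [hεβ] at h2
    have h3 := mul_le_mul_of_nonneg_left ht
      (ensembleErrorProb_nonneg (coverEnsemble (Γ t)) h0 (by linarith))
    rw [div_mul_eq_mul_div, le_div_iff₀ hβ0]
    linarith
  refine squeeze_zero' (Eventually.of_forall fun t =>
    ensembleErrorProb_nonneg _ h0 (by linarith)) hbound ?_
  simpa using h.const_mul (2 / β)

theorem mainTheorem1 (dv k : ℕ) (hdv : 2 < dv) (hodd : Odd dv) (hk : 2 ≤ k) :
    ∃ ν : ℝ, 0 < ν ∧
      ∀ (L M : ℕ → ℕ) (Γ : ∀ t, PMF (GraphCoverCode dv k (L t) (M t))),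
        Filter.Tendsto L Filter.atTop Filter.atTop →
        (∀ t, 0 < M t) →
        (∀ t, k ∣ M t) →
        (fun t => (M t : ℝ)) =o[Filter.atTop] (fun t => (L t : ℝ) ^ ν) →
        (∀ Δ : ℝ, 0 < Δ → Δ < lpThreshold (fun t => coupledEnsemble (Γ t)) →
          (fun t => ensembleErrorProb (coupledEnsemble (Γ t))
              (lpThreshold (fun t => coupledEnsemble (Γ t)) - Δ))
            =o[Filter.atTop] (fun t => 1 / (L t : ℝ) ^ 2)) →
        lpThreshold (fun t => coverEnsemble (Γ t)) =
          lpThreshold (fun t => coupledEnsemble (Γ t)) := by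
  -- The exponent 1 is enough, since the repair price only needs `M / L → 0`.
  refine ⟨1, one_pos, fun L M Γ _ hM hkM hML _ => ?_⟩
  simp only [Real.rpow_one] at hML
  have hMk : ∀ t, 0 < M t / k := fun t =>
    Nat.div_pos (Nat.le_of_dvd (hM t) (hkM t)) (by omega)
  have hbdd : ∀ G : ℕ → PMF TannerGraph, BddAbove {ε : ℝ | 0 < ε ∧ ε < 1 / 2 ∧
      (fun t => ensembleErrorProb (G t) ε) =o[Filter.atTop] (fun _ => (1 : ℝ))} :=
    fun G => ⟨1 / 2, fun ε hε => hε.2.1.le⟩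
  refine le_antisymm ?_ ?_
  · refine Real.sSup_le (fun ε hε => le_csSup (hbdd _) ⟨hε.1, hε.2.1, ?_⟩)
      (Real.sSup_nonneg fun ε hε => hε.1.le)
    have h := hε.2.2
    rw [Asymptotics.isLittleO_one_iff] at h ⊢
    have h0 : 0 ≤ ε := hε.1.le
    have h1 : ε ≤ 1 := by linarith [hε.2.1]
    exact squeeze_zero (fun t => ensembleErrorProb_nonneg _ h0 h1)
      (fun t => ensembleErrorProb_coupledEnsemble_le (hMk t) (Γ t) h0 h1) h
  · refine Real.sSup_le (fun ε hε => le_of_forall_lt fun a ha => ?_)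
      (Real.sSup_nonneg fun ε hε => hε.1.le)
    -- The maximum with 0 keeps `ε'` an admissible crossover probability when `a` is negative.
    obtain ⟨ε', haε', hε'⟩ := exists_between (max_lt ha hε.1)
    refine (le_max_left a 0).trans_lt (haε'.trans_le (le_csSup (hbdd _) ⟨?_, ?_, ?_⟩))
    · exact (le_max_right a 0).trans_lt haε'
    · exact hε'.trans hε.2.1
    · have h := hε.2.2
      rw [Asymptotics.isLittleO_one_iff] at h ⊢
      exact tendsto_coverEnsemble_of_coupledEnsemble hk Γ hMk hML
        ((le_max_right a 0).trans haε'.le) hε' (by linarith [hε.2.1]) h
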